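/- Let $X$ be a regular $T_1$ topological space. Then: 1. $X$ is developable if and only if it is a semi-stratifiable weakly $w\Delta$-space. 2. $X$ is metrizable if and only if it is a stratifiable weakly $w\Delta$-space. Here $X$ is *developable* if there is a sequence $(\mathcal G_n)_n$ of open covers of $X$ such that, for every $x\in X$, the sets $\mathrm{St}(x,\mathcal G_n)=\bigcup\{G\in\mathcal G_n : x\in G\}$, $n\in\mathbb N$, form a base at $x$. $X$ is a *weakly $w\Delta$-space* if there is a sequence $(\mathcal G_n)_n$ of open covers of $X$ such that, whenever $x\in G_n\in\mathcal G_n$ for every $n$ and $x_n\in\bigcap_{k\le n}G_k$ for every $n$, the sequence $(x_n)_n$ has a cluster point in $X$. $X$ is *semi-stratifiable* if one can assign to every $n\in\mathbb N$ and every closed set $H\subseteq X$ an open set $S(n,H)\supseteq H$ such that $\bigcap_n S(n,H)=H$ for every closed $H$, and $S(n,H)\subseteq S(n,K)$ for all $n$ and all closed $H\subseteq K$. $X$ is *stratifiable* if this can be done with, in addition, $\bigcap_n\overline{S(n,H)}=H$ for every closed $H$. -/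

import Mathlib

open Set Filter Topology

namespace GenMetric

variable {X : Type*}

/-- The star of the point `x` with respect to the family `𝒢`: the union of all members of `𝒢`
that contain `x`. -/
def star (x : X) (𝒢 : Set (Set X)) : Set X :=
  ⋃₀ {G | G ∈ 𝒢 ∧ x ∈ G}

variable [TopologicalSpace X]

/-- A family of open subsets of `X` that covers `X`. -/
def IsOpenCovering (𝒢 : Set (Set X)) : Prop :=
  (∀ G ∈ 𝒢, IsOpen G) ∧ ⋃₀ 𝒢 = univ

/-- A development: a sequence of open covers such that, for each point `x`, the sequence of
stars of `x` is a base at `x`. -/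
def IsDevelopment (𝒢 : ℕ → Set (Set X)) : Prop :=
  (∀ n, IsOpenCovering (𝒢 n)) ∧
    ∀ x : X, (𝓝 x).HasBasis (fun _ : ℕ => True) (fun n => star x (𝒢 n))

/-- A weakly wΔ-sequence: a sequence of open covers such that, whenever `x ∈ G n ∈ 𝒢 n` for
all `n` and `y n ∈ ⋂ k ≤ n, G k` for all `n`, the sequence `y` has a cluster point. -/
def IsWeaklyWDeltaSequence (𝒢 : ℕ → Set (Set X)) : Prop :=
  (∀ n, IsOpenCovering (𝒢 n)) ∧
    ∀ (x : X) (G : ℕ → Set X), (∀ n, G n ∈ 𝒢 n ∧ x ∈ G n) →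
      ∀ y : ℕ → X, (∀ n, y n ∈ ⋂ k ≤ n, G k) → ∃ z : X, MapClusterPt z atTop y

variable (X)

/-- A developable space: it has a development. -/
def Developable : Prop :=
  ∃ 𝒢 : ℕ → Set (Set X), IsDevelopment 𝒢

/-- A weakly wΔ-space: it has a weakly wΔ-sequence. -/
def WeaklyWDeltaSpace : Prop :=
  ∃ 𝒢 : ℕ → Set (Set X), IsWeaklyWDeltaSequence 𝒢

/-- A semi-stratifiable space: to each `n` and each closed set `H` one can assign an open set
`S n H` containing `H`, monotone in `H`, with `⋂ n, S n H = H`.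
(The values of `S` on sets that are not closed are irrelevant.) -/
def SemiStratifiable : Prop :=
  ∃ S : ℕ → Set X → Set X,
    (∀ n H, IsClosed H → IsOpen (S n H) ∧ H ⊆ S n H) ∧
    (∀ H, IsClosed H → ⋂ n, S n H = H) ∧
    ∀ n H K, IsClosed H → IsClosed K → H ⊆ K → S n H ⊆ S n K

/-- A stratifiable space: as for semi-stratifiable spaces, with the stronger requirement
`⋂ n, closure (S n H) = H`. -/
def Stratifiable : Prop :=
  ∃ S : ℕ → Set X → Set X,
    (∀ n H, IsClosed H → IsOpen (S n H) ∧ H ⊆ S n H) ∧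
    (∀ H, IsClosed H → ⋂ n, closure (S n H) = H) ∧
    ∀ n H K, IsClosed H → IsClosed K → H ⊆ K → S n H ⊆ S n K

end GenMetric

/-!
The point where the two halves of the theorem meet is a refinement device available in every
semi-stratifiable space. For a semi-stratification `S` that decreases in `n`, an open set `V` is the
increasing union of the closed sets `core S n V = (S n Vᶜ)ᶜ`, and `core S n` is monotone in `V`.
Given an open cover `U` indexed by a well-ordered type, put

* `tailPiece S U n i = U i \ core S n (⋃ j < i, U j)`, an open cover that refines `U`;
* `corePiece S U n i = core S n (⋃ j ≤ i, U j) \ ⋃ j < i, U j`, closed sets inside the `U i`.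

If `i` is the least index with `x ∈ U i`, then for all large `n` the only tail piece that contains
`x` is the one with index `i`: the star of `x` is a single open set
(`exists_forall_mem_tailPiece_imp_eq`). Moreover `tailPiece S U n i` meets `corePiece S U n j` only
for `j = i`, so for fixed `n` the core pieces form a discrete family; over all `n` they cover `X`.

*Developable spaces.* In a regular T₁ semi-stratifiable space a weakly wΔ-sequence `𝒢` can be refined
to open covers `U n` such that the closure of `U n p` lies in `S n {p}`. If `x ∈ U n (p n)` for
all `n`, then `⋂ n, closure (U n (p n))` contains only `x`, because any point lying in all
`S n {p n}` is a limit of `p`. Hence every cluster point provided by the wΔ-property is `x` itself,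
and the finite intersections of the `U n (p n)` form a base at `x`. The stars of the tail pieces are
eventually contained in such finite intersections, so finite meets of the covers by tail pieces form
a development.

*Metrizable spaces.* A stratifiable space is monotonically normal, through the operator
`separation S F H = ⋃ n, S n F \ closure (S n H)`. Monotonicity expands a discrete closed family to
pairwise disjoint open sets, and one Urysohn function then yields a continuous map to a space of
functions with the topology of uniform convergence, which separates each member of the family from
the complement of a prescribed neighbourhood. Applying this to the core pieces of all covers of a
development embeds `X` in a countable product of pseudometrizable spaces.
-/

namespace GenMetric

variable {X : Type*}

theorem mem_star_iff {x y : X} {𝒢 : Set (Set X)} :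
    y ∈ star x 𝒢 ↔ ∃ G ∈ 𝒢, x ∈ G ∧ y ∈ G := by
  constructor
  · rintro ⟨G, ⟨hG, hx⟩, hy⟩
    exact ⟨G, hG, hx, hy⟩
  · rintro ⟨G, hG, hx, hy⟩
    exact ⟨G, ⟨hG, hx⟩, hy⟩

variable [TopologicalSpace X]

theorem IsOpenCovering.exists_mem {𝒢 : Set (Set X)} (h : IsOpenCovering 𝒢) (x : X) :
    ∃ G ∈ 𝒢, x ∈ G := by
  have hx : x ∈ ⋃₀ 𝒢 := h.2 ▸ mem_univ x
  exact hx

/-! ### Consequences of developability and metrizability -/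

theorem IsDevelopment.semiStratifiable {𝒢 : ℕ → Set (Set X)} (h : IsDevelopment 𝒢) :
    SemiStratifiable X := by
  have sub : ∀ n H, H ⊆ ⋃₀ {G | G ∈ 𝒢 n ∧ (G ∩ H).Nonempty} := fun n H x hx => by
    obtain ⟨G, hG, hxG⟩ := (h.1 n).exists_mem x
    exact ⟨G, ⟨hG, x, hxG, hx⟩, hxG⟩
  refine ⟨fun n H => ⋃₀ {G | G ∈ 𝒢 n ∧ (G ∩ H).Nonempty}, fun n H _ => ⟨?_, sub n H⟩, ?_, ?_⟩
  · exact isOpen_sUnion fun G hG => (h.1 n).1 G hG.1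
  · refine fun H hH => Subset.antisymm (fun x hx => ?_) (subset_iInter fun n => sub n H)
    by_contra hxH
    obtain ⟨n, -, hn⟩ := (h.2 x).mem_iff.1 (hH.isOpen_compl.mem_nhds hxH)
    obtain ⟨G, ⟨hG, y, hyG, hyH⟩, hxG⟩ := mem_iInter.1 hx n
    exact hn (mem_star_iff.2 ⟨G, hG, hxG, hyG⟩) hyH
  · rintro n H K - - hHK x ⟨G, ⟨hG, hne⟩, hxG⟩
    exact ⟨G, ⟨hG, hne.mono (inter_subset_inter_right G hHK)⟩, hxG⟩

theorem IsDevelopment.isWeaklyWDeltaSequence {𝒢 : ℕ → Set (Set X)} (h : IsDevelopment 𝒢) :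
    IsWeaklyWDeltaSequence 𝒢 := by
  refine ⟨h.1, fun x G hG y hy => ⟨x, Tendsto.mapClusterPt ?_⟩⟩
  refine (h.2 x).tendsto_right_iff.2 fun k _ => ?_
  filter_upwards [eventually_ge_atTop k] with n hn
  exact mem_star_iff.2 ⟨G k, (hG k).1, (hG k).2, mem_iInter₂.1 (hy n) k hn⟩

theorem developable_of_metrizableSpace [TopologicalSpace.MetrizableSpace X] :
    Developable X := by
  let := TopologicalSpace.metrizableSpaceMetric X
  have pos : ∀ n : ℕ, (0 : ℝ) < 1 / (n + 1) := fun n => Nat.one_div_pos_of_nat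
  have cov : ∀ n : ℕ, IsOpenCovering (range fun p : X => Metric.ball p (1 / ((n : ℝ) + 1))) := by
    refine fun n => ⟨?_, ?_⟩
    · rintro _ ⟨p, rfl⟩
      exact Metric.isOpen_ball
    · exact eq_univ_of_forall fun x => ⟨_, ⟨x, rfl⟩, Metric.mem_ball_self (pos n)⟩
  refine ⟨fun n => range fun p : X => Metric.ball p (1 / ((n : ℝ) + 1)), cov, fun x => ⟨fun s => ?_⟩⟩
  constructor
  · intro hs
    obtain ⟨ε, hε, hb⟩ := Metric.mem_nhds_iff.1 hs
    obtain ⟨n, hn⟩ := exists_nat_one_div_lt (half_pos hε)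
    refine ⟨n, trivial, fun y hy => hb ?_⟩
    obtain ⟨_, ⟨p, rfl⟩, hx, hy⟩ := mem_star_iff.1 hy
    rw [Metric.mem_ball] at hx hy ⊢
    linarith [dist_triangle_right y x p]
  · rintro ⟨n, -, hn⟩
    refine mem_of_superset (Metric.ball_mem_nhds x (pos n)) (Subset.trans (fun y hy => ?_) hn)
    exact mem_star_iff.2 ⟨_, ⟨x, rfl⟩, Metric.mem_ball_self (pos n), hy⟩

theorem stratifiable_of_metrizableSpace [TopologicalSpace.MetrizableSpace X] :
    Stratifiable X := by
  let := TopologicalSpace.metrizableSpaceMetric X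
  have pos : ∀ n : ℕ, (0 : ℝ) < 1 / (n + 1) := fun n => Nat.one_div_pos_of_nat
  refine ⟨fun n H => Metric.thickening (1 / ((n : ℝ) + 1)) H, fun n H _ =>
    ⟨Metric.isOpen_thickening, Metric.self_subset_thickening (pos n) H⟩, fun H hH => ?_,
    fun n H K _ _ hHK => Metric.thickening_subset_of_subset _ hHK⟩
  refine Subset.antisymm ?_ (subset_iInter fun n =>
    (Metric.self_subset_thickening (pos n) H).trans subset_closure)
  conv_rhs => rw [← hH.closure_eq, Metric.closure_eq_iInter_cthickening]
  refine subset_iInter₂ fun ε hε => ?_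
  obtain ⟨n, hn⟩ := exists_nat_one_div_lt hε
  exact (iInter_subset _ n).trans <| (Metric.closure_thickening_subset_cthickening _ H).trans
    (Metric.cthickening_mono hn.le H)

/-! ### Decreasing semi-stratifications -/

/-- A semi-stratification that decreases in the first argument. -/
structure IsDecreasingSemiStratification (S : ℕ → Set X → Set X) : Prop where
  isOpen : ∀ n {H}, IsClosed H → IsOpen (S n H)
  subset : ∀ n {H}, IsClosed H → H ⊆ S n H
  iInter_eq : ∀ {H}, IsClosed H → ⋂ n, S n H = H
  mono : ∀ n {H K}, IsClosed H → IsClosed K → H ⊆ K → S n H ⊆ S n K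
  anti : ∀ {m n} H, m ≤ n → S n H ⊆ S m H

theorem SemiStratifiable.exists_decreasing (h : SemiStratifiable X) :
    ∃ S : ℕ → Set X → Set X, IsDecreasingSemiStratification S := by
  obtain ⟨S, h1, h2, h3⟩ := h
  have sub : ∀ n H, IsClosed H → H ⊆ ⋂ k ∈ Iic n, S k H := fun n H hH =>
    subset_iInter₂ fun k _ => (h1 k H hH).2
  refine ⟨fun n H => ⋂ k ∈ Iic n, S k H, ?_, ?_, ?_, ?_, ?_⟩
  · exact fun n H hH => (finite_Iic n).isOpen_biInter fun k _ => (h1 k H hH).1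
  · exact fun n H hH => sub n H hH
  · refine fun {H} hH => Subset.antisymm ?_ (subset_iInter fun n => sub n H hH)
    conv_rhs => rw [← h2 H hH]
    exact iInter_mono fun n => biInter_subset_of_mem (mem_Iic.2 le_rfl)
  · exact fun n H K hH hK hHK => iInter₂_mono fun k _ => h3 k H K hH hK hHK
  · exact fun H hmn => biInter_subset_biInter_left (Iic_subset_Iic.2 hmn)

theorem Stratifiable.exists_decreasing (h : Stratifiable X) :
    ∃ S : ℕ → Set X → Set X, IsDecreasingSemiStratification S ∧
      ∀ H, IsClosed H → ⋂ n, closure (S n H) = H := by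
  obtain ⟨S, h1, h2, h3⟩ := h
  have sub : ∀ n H, IsClosed H → H ⊆ ⋂ k ∈ Iic n, S k H := fun n H hH =>
    subset_iInter₂ fun k _ => (h1 k H hH).2
  have key : ∀ H, IsClosed H → ⋂ n, closure (⋂ k ∈ Iic n, S k H) ⊆ H := fun H hH => by
    conv_rhs => rw [← h2 H hH]
    exact iInter_mono fun n => closure_mono (biInter_subset_of_mem (mem_Iic.2 le_rfl))
  refine ⟨fun n H => ⋂ k ∈ Iic n, S k H, ⟨?_, ?_, ?_, ?_, ?_⟩, ?_⟩
  · exact fun n H hH => (finite_Iic n).isOpen_biInter fun k _ => (h1 k H hH).1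
  · exact fun n H hH => sub n H hH
  · exact fun {H} hH => Subset.antisymm ((iInter_mono fun n => subset_closure).trans (key H hH))
      (subset_iInter fun n => sub n H hH)
  · exact fun n H K hH hK hHK => iInter₂_mono fun k _ => h3 k H K hH hK hHK
  · exact fun H hmn => biInter_subset_biInter_left (Iic_subset_Iic.2 hmn)
  · exact fun H hH => Subset.antisymm (key H hH)
      (subset_iInter fun n => (sub n H hH).trans subset_closure)

theorem Stratifiable.semiStratifiable (h : Stratifiable X) : SemiStratifiable X := by
  obtain ⟨S, hS, -⟩ := h.exists_decreasing
  exact ⟨S, fun n H hH => ⟨hS.isOpen n hH, hS.subset n hH⟩, fun H hH => hS.iInter_eq hH,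
    fun n H K hH hK => hS.mono n hH hK⟩

omit [TopologicalSpace X] in
/-- The part of `V` at level `n`: the complement of the neighbourhood of `Vᶜ` assigned by `S`. For
a decreasing semi-stratification and `V` open, these are closed sets increasing to `V`. -/
def core (S : ℕ → Set X → Set X) (n : ℕ) (V : Set X) : Set X :=
  (S n Vᶜ)ᶜ

namespace IsDecreasingSemiStratification

variable {S : ℕ → Set X → Set X} (hS : IsDecreasingSemiStratification S)
include hS

theorem isClosed_core (n : ℕ) {V : Set X} (hV : IsOpen V) : IsClosed (core S n V) :=
  (hS.isOpen n hV.isClosed_compl).isClosed_compl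

theorem core_subset (n : ℕ) {V : Set X} (hV : IsOpen V) : core S n V ⊆ V :=
  compl_subset_comm.1 (hS.subset n hV.isClosed_compl)

theorem core_mono (n : ℕ) {V W : Set X} (hV : IsOpen V) (hW : IsOpen W) (h : V ⊆ W) :
    core S n V ⊆ core S n W :=
  compl_subset_compl.2 (hS.mono n hW.isClosed_compl hV.isClosed_compl (compl_subset_compl.2 h))

theorem exists_forall_mem_core {V : Set X} (hV : IsOpen V) {x : X} (hx : x ∈ V) :
    ∃ N, ∀ n ≥ N, x ∈ core S n V := by
  have h : x ∉ ⋂ n, S n Vᶜ := by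
    rw [hS.iInter_eq hV.isClosed_compl]
    exact not_not.2 hx
  obtain ⟨N, hN⟩ := not_forall.1 (mt mem_iInter.2 h)
  exact ⟨N, fun n hn hxn => hN (hS.anti _ hn hxn)⟩

theorem tendsto_of_mem_singleton [T1Space X] {x : X} {p : ℕ → X}
    (h : ∀ n, x ∈ S n {p n}) : Tendsto p atTop (𝓝 x) := by
  refine tendsto_atTop_nhds.2 fun V hxV hV => ?_
  obtain ⟨N, hN⟩ := hS.exists_forall_mem_core hV hxV
  refine ⟨N, fun n hn => by_contra fun hp => hN n hn ?_⟩
  exact hS.mono n isClosed_singleton hV.isClosed_compl (singleton_subset_iff.2 hp) (h n)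

end IsDecreasingSemiStratification

/-! ### Refining a well-ordered open cover -/

section Pieces

variable {ι : Type*} [LinearOrder ι]

/-- The `i`-th member of the open refinement of level `n` of the cover `U`: the set `U i` without
the core of the union of the earlier members. -/
def tailPiece (S : ℕ → Set X → Set X) (U : ι → Set X) (n : ℕ) (i : ι) : Set X :=
  U i \ core S n (⋃ j < i, U j)

/-- The `i`-th member of the discrete closed family of level `n` subordinate to the cover `U`: the
core of the union of the members up to `i`, without the earlier members. -/
def corePiece (S : ℕ → Set X → Set X) (U : ι → Set X) (n : ℕ) (i : ι) : Set X :=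
  core S n (⋃ j ≤ i, U j) \ ⋃ j < i, U j

variable {S : ℕ → Set X → Set X} {U : ι → Set X}

omit [TopologicalSpace X] in
theorem tailPiece_subset (n : ℕ) (i : ι) : tailPiece S U n i ⊆ U i :=
  sdiff_subset

variable (hS : IsDecreasingSemiStratification S) (hU : ∀ i, IsOpen (U i))
include hS hU

theorem isOpen_tailPiece (n : ℕ) (i : ι) : IsOpen (tailPiece S U n i) :=
  (hU i).sdiff (hS.isClosed_core n (isOpen_biUnion fun j _ => hU j))

theorem isClosed_corePiece (n : ℕ) (i : ι) : IsClosed (corePiece S U n i) :=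
  (hS.isClosed_core n (isOpen_biUnion fun j _ => hU j)).sdiff (isOpen_biUnion fun j _ => hU j)

theorem corePiece_subset (n : ℕ) (i : ι) : corePiece S U n i ⊆ U i := by
  rintro x ⟨hx, hx'⟩
  obtain ⟨j, hj, hxj⟩ := mem_iUnion₂.1
    (hS.core_subset n (isOpen_biUnion fun j _ => hU j) hx)
  rcases lt_or_eq_of_le (show j ≤ i from hj) with hj | rfl
  · exact absurd (mem_iUnion₂.2 ⟨j, hj, hxj⟩) hx'
  · exact hxj

theorem eq_of_mem_tailPiece_of_mem_corePiece {n : ℕ} {i j : ι} {x : X}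
    (hi : x ∈ tailPiece S U n i) (hj : x ∈ corePiece S U n j) : i = j := by
  rcases lt_trichotomy i j with h | h | h
  · exact absurd (mem_iUnion₂.2 ⟨i, h, hi.1⟩) hj.2
  · exact h
  · refine absurd (hS.core_mono n ?_ ?_ ?_ hj.1) hi.2
    · exact isOpen_biUnion fun k _ => hU k
    · exact isOpen_biUnion fun k _ => hU k
    · exact biUnion_mono (fun k hk => lt_of_le_of_lt hk h) fun k _ => Subset.rfl

variable [WellFoundedLT ι] (hcov : ∀ x, ∃ i, x ∈ U i)
include hcov

omit [TopologicalSpace X] hS hU in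
theorem exists_least_mem (x : X) : ∃ i, x ∈ U i ∧ x ∉ ⋃ j < i, U j := by
  obtain ⟨i, hi, hmin⟩ := wellFounded_lt.has_min {i | x ∈ U i} (hcov x)
  refine ⟨i, hi, fun hx => ?_⟩
  obtain ⟨j, hj, hxj⟩ := mem_iUnion₂.1 hx
  exact hmin j hxj hj

theorem exists_mem_tailPiece (n : ℕ) (x : X) : ∃ i, x ∈ tailPiece S U n i := by
  obtain ⟨i, hi, hx⟩ := exists_least_mem hcov x
  exact ⟨i, hi, fun h => hx (hS.core_subset n (isOpen_biUnion fun j _ => hU j) h)⟩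

/-- For all large `n` the star of `x` in the cover by the tail pieces of level `n` is a single
tail piece. -/
theorem exists_forall_mem_tailPiece_imp_eq (x : X) :
    ∃ i, x ∈ U i ∧ ∃ N, ∀ n ≥ N, ∀ j, x ∈ tailPiece S U n j → j = i := by
  obtain ⟨i, hi, hx⟩ := exists_least_mem hcov x
  obtain ⟨N, hN⟩ := hS.exists_forall_mem_core (hU i) hi
  refine ⟨i, hi, N, fun n hn j hj => ?_⟩
  rcases lt_trichotomy j i with h | h | h
  · exact absurd (mem_iUnion₂.2 ⟨j, h, hj.1⟩) hx
  · exact h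
  · exact absurd (hS.core_mono n (hU i) (isOpen_biUnion fun k _ => hU k)
      (subset_biUnion_of_mem (u := U) (show i ∈ {k | k < j} from h)) (hN n hn)) hj.2

theorem exists_mem_corePiece (x : X) : ∃ n i, x ∈ corePiece S U n i := by
  obtain ⟨i, hi, hx⟩ := exists_least_mem hcov x
  obtain ⟨N, hN⟩ := hS.exists_forall_mem_core (V := ⋃ j ≤ i, U j)
    (isOpen_biUnion fun k _ => hU k) (mem_iUnion₂.2 ⟨i, le_rfl, hi⟩)
  exact ⟨N, i, hN N le_rfl, hx⟩

/-- The core pieces of a fixed level form a discrete family. -/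
theorem exists_nhds_corePiece_eq (n : ℕ) (x : X) :
    ∃ t ∈ 𝓝 x, ∃ i, ∀ j, (corePiece S U n j ∩ t).Nonempty → j = i := by
  obtain ⟨i, hi⟩ := exists_mem_tailPiece hS hU hcov n x
  refine ⟨_, (isOpen_tailPiece hS hU n i).mem_nhds hi, i, fun j ⟨y, hyj, hyi⟩ => ?_⟩
  exact (eq_of_mem_tailPiece_of_mem_corePiece hS hU hyi hyj).symm

end Pieces

/-! ### Developability of semi-stratifiable weakly wΔ-spaces -/

/-- Regularity turns a weakly wΔ-sequence into one indexed by points whose closures are controlled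
by the semi-stratification. -/
theorem IsWeaklyWDeltaSequence.exists_indexed_refinement [T1Space X] [RegularSpace X]
    {S : ℕ → Set X → Set X} (hS : IsDecreasingSemiStratification S) {𝒢 : ℕ → Set (Set X)}
    (h𝒢 : IsWeaklyWDeltaSequence 𝒢) :
    ∃ U : ℕ → X → Set X, (∀ n p, IsOpen (U n p)) ∧ (∀ n p, p ∈ U n p) ∧
      (∀ n p, closure (U n p) ⊆ S n {p}) ∧ ∀ n p, ∃ G ∈ 𝒢 n, U n p ⊆ G := by
  have : ∀ (n : ℕ) (p : X), ∃ U : Set X, IsOpen U ∧ p ∈ U ∧ closure U ⊆ S n {p} ∧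
      ∃ G ∈ 𝒢 n, U ⊆ G := fun n p => by
    obtain ⟨G, hG, hpG⟩ := (h𝒢.1 n).exists_mem p
    have hp : G ∩ S n {p} ∈ 𝓝 p := inter_mem (((h𝒢.1 n).1 G hG).mem_nhds hpG)
      ((hS.isOpen n isClosed_singleton).mem_nhds (hS.subset n isClosed_singleton rfl))
    obtain ⟨t, ht, htc, hts⟩ := exists_mem_nhds_isClosed_subset hp
    refine ⟨interior t, isOpen_interior, mem_interior_iff_mem_nhds.2 ht, ?_, G, hG, ?_⟩
    · exact (closure_minimal interior_subset htc).trans (hts.trans inter_subset_right)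
    · exact interior_subset.trans (hts.trans inter_subset_left)
  choose U h1 h2 h3 h4 using this
  exact ⟨U, h1, h2, h3, h4⟩

/-- The finite intersections of members of the refinement containing `x` form a base at `x`: a
sequence witnessing the contrary has a cluster point, which can only be `x`. -/
theorem IsWeaklyWDeltaSequence.exists_biInter_subset [T2Space X]
    {S : ℕ → Set X → Set X} (hS : IsDecreasingSemiStratification S) {𝒢 : ℕ → Set (Set X)}
    (h𝒢 : IsWeaklyWDeltaSequence 𝒢) {U : ℕ → X → Set X}
    (hcl : ∀ n p, closure (U n p) ⊆ S n {p}) (hUG : ∀ n p, ∃ G ∈ 𝒢 n, U n p ⊆ G)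
    {x : X} {p : ℕ → X} (hx : ∀ n, x ∈ U n (p n)) {O : Set X} (hO : O ∈ 𝓝 x) :
    ∃ n, ⋂ k ≤ n, U k (p k) ⊆ O := by
  by_contra! hne
  choose y hyU hyO using fun n => not_subset.1 (hne n)
  choose G hG hUG using fun n => hUG n (p n)
  obtain ⟨z, hz⟩ := h𝒢.2 x G (fun n => ⟨hG n, hUG n (hx n)⟩) y fun n =>
    mem_iInter₂.2 fun k hk => hUG k (mem_iInter₂.1 (hyU n) k hk)
  have hzU : ∀ n, z ∈ closure (U n (p n)) := fun n => by
    refine mem_closure_iff_clusterPt.2 (ClusterPt.mono hz ?_)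
    refine le_principal_iff.2 (mem_map.2 ?_)
    filter_upwards [eventually_ge_atTop n] with m hm
    exact mem_iInter₂.1 (hyU m) n hm
  have hzx : z = x := tendsto_nhds_unique
    (hS.tendsto_of_mem_singleton fun n => hcl n (p n) (hzU n))
    (hS.tendsto_of_mem_singleton fun n => hcl n (p n) (subset_closure (hx n)))
  subst hzx
  obtain ⟨n, hn⟩ := (mapClusterPt_iff_frequently.1 hz O hO).exists
  exact hyO n hn

theorem SemiStratifiable.developable [T1Space X] [RegularSpace X] (h : SemiStratifiable X)
    (hw : WeaklyWDeltaSpace X) : Developable X := by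
  obtain ⟨S, hS⟩ := h.exists_decreasing
  obtain ⟨𝒢, h𝒢⟩ := hw
  obtain ⟨U, hUo, hUm, hcl, hUG⟩ := h𝒢.exists_indexed_refinement hS
  obtain ⟨_, _⟩ := exists_wellFoundedLT (α := X)
  have hcov : ∀ n x, ∃ i, x ∈ U n i := fun n x => ⟨x, hUm n x⟩
  -- `meet N c` picks one tail piece from each of the covers `(n, m)` with `n, m ≤ N`.
  let meet : ℕ → (ℕ → ℕ → X) → Set X := fun N c =>
    ⋂ n ∈ Iic N, ⋂ m ∈ Iic N, tailPiece S (U n) m (c n m)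
  have hopen : ∀ N c, IsOpen (meet N c) := fun N c =>
    (finite_Iic N).isOpen_biInter fun n _ => (finite_Iic N).isOpen_biInter fun m _ =>
      isOpen_tailPiece hS (hUo n) m _
  have hmeet : ∀ x, ∃ c, ∀ N, x ∈ meet N c := fun x => by
    choose c hc using fun n m => exists_mem_tailPiece hS (hUo n) (hcov n) m x
    exact ⟨c, fun N => mem_iInter₂.2 fun n _ => mem_iInter₂.2 fun m _ => hc n m⟩
  refine ⟨fun N => range (meet N), fun N => ⟨?_, ?_⟩, fun x => ⟨fun O => ⟨fun hO => ?_, ?_⟩⟩⟩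
  · rintro _ ⟨c, rfl⟩
    exact hopen N c
  · refine eq_univ_of_forall fun x => ?_
    obtain ⟨c, hc⟩ := hmeet x
    exact ⟨_, ⟨c, rfl⟩, hc N⟩
  · choose p hp M hM using fun n => exists_forall_mem_tailPiece_imp_eq hS (hUo n) (hcov n) x
    have hstar : ∀ n, ∀ᶠ N in atTop, star x (range (meet N)) ⊆ U n (p n) := fun n => by
      filter_upwards [eventually_ge_atTop n, eventually_ge_atTop (M n)] with N hn hMN y hy
      obtain ⟨_, ⟨c, rfl⟩, hxc, hyc⟩ := mem_star_iff.1 hy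
      have hxc' := mem_iInter₂.1 (mem_iInter₂.1 hxc n hn) (M n) hMN
      have hyc' := mem_iInter₂.1 (mem_iInter₂.1 hyc n hn) (M n) hMN
      rw [hM n (M n) le_rfl _ hxc'] at hyc'
      exact tailPiece_subset _ _ hyc'
    obtain ⟨n, hn⟩ := h𝒢.exists_biInter_subset hS hcl hUG hp hO
    obtain ⟨N, hN⟩ := ((finite_Iic n).eventually_all.2 fun k _ => hstar k).exists
    exact ⟨N, trivial, (subset_iInter₂ fun k hk => hN k hk).trans hn⟩
  · rintro ⟨N, -, hN⟩
    obtain ⟨c, hc⟩ := hmeet x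
    refine mem_of_superset ((hopen N c).mem_nhds (hc N)) (Subset.trans (fun y hy => ?_) hN)
    exact mem_star_iff.2 ⟨_, ⟨c, rfl⟩, hc N, hy⟩

/-! ### Monotone normality of stratifiable spaces -/

/-- The monotone normality operator of a stratification: for disjoint closed `F` and `H`, an open
set around `F`, increasing in `F` and decreasing in `H`, that is disjoint from the one with `F` and
`H` exchanged. -/
def separation (S : ℕ → Set X → Set X) (F H : Set X) : Set X :=
  ⋃ n, S n F \ closure (S n H)

section Separation

variable {S : ℕ → Set X → Set X} (hS : IsDecreasingSemiStratification S)
include hS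

theorem isOpen_separation {F : Set X} (hF : IsClosed F) (H : Set X) :
    IsOpen (separation S F H) :=
  isOpen_iUnion fun n => (hS.isOpen n hF).sdiff isClosed_closure

theorem subset_separation (hcl : ∀ H, IsClosed H → ⋂ n, closure (S n H) = H) {F H : Set X}
    (hF : IsClosed F) (hH : IsClosed H) (hFH : Disjoint F H) : F ⊆ separation S F H := by
  intro x hx
  have hxH : x ∉ ⋂ n, closure (S n H) := by
    rw [hcl H hH]
    exact disjoint_left.1 hFH hx
  obtain ⟨n, hn⟩ := not_forall.1 (mt mem_iInter.2 hxH)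
  exact mem_iUnion.2 ⟨n, hS.subset n hF hx, hn⟩

theorem separation_anti_right (F : Set X) {H K : Set X} (hH : IsClosed H) (hK : IsClosed K)
    (hHK : H ⊆ K) : separation S F K ⊆ separation S F H :=
  iUnion_mono fun n => sdiff_subset_sdiff_right (closure_mono (hS.mono n hH hK hHK))

theorem disjoint_separation (F H : Set X) :
    Disjoint (separation S F H) (separation S H F) := by
  refine disjoint_left.2 fun x hx hx' => ?_
  obtain ⟨n, hn, hn'⟩ := mem_iUnion.1 hx
  obtain ⟨m, hm, hm'⟩ := mem_iUnion.1 hx'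
  rcases le_total n m with h | h
  · exact hn' (subset_closure (hS.anti H h hm))
  · exact hm' (subset_closure (hS.anti F h hn))

theorem normalSpace_of_stratification (hcl : ∀ H, IsClosed H → ⋂ n, closure (S n H) = H) :
    NormalSpace X :=
  ⟨fun F H hF hH hFH => ⟨separation S F H, separation S H F, isOpen_separation hS hF H,
    isOpen_separation hS hH F, subset_separation hS hcl hF hH hFH,
    subset_separation hS hcl hH hF hFH.symm, disjoint_separation hS F H⟩⟩

/-- A stratifiable space is collectionwise normal, with the expansion of a discrete closed family
inside prescribed open neighbourhoods: each `F i` is separated from the union of the others. -/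
theorem exists_pairwise_disjoint_expansion
    (hcl : ∀ H, IsClosed H → ⋂ n, closure (S n H) = H) {ι : Type*} {F U : ι → Set X}
    (hF : ∀ i, IsClosed (F i)) (hlf : LocallyFinite F) (hdisj : Pairwise (Function.onFun Disjoint F))
    (hU : ∀ i, IsOpen (U i)) (hFU : ∀ i, F i ⊆ U i) :
    ∃ O : ι → Set X, (∀ i, IsOpen (O i)) ∧ (∀ i, F i ⊆ O i) ∧ (∀ i, O i ⊆ U i) ∧
      Pairwise (Function.onFun Disjoint O) := by
  let H : ι → Set X := fun i => ⋃ j : {j // j ≠ i}, F j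
  have hH : ∀ i, IsClosed (H i) := fun i =>
    (hlf.comp_injective Subtype.val_injective).isClosed_iUnion fun j => hF j
  have hFH : ∀ i, Disjoint (F i) (H i) := fun i =>
    disjoint_iUnion_right.2 fun j => hdisj j.2.symm
  have hsub : ∀ i j, j ≠ i → F j ⊆ H i := fun i j hj =>
    subset_iUnion (fun j : {j // j ≠ i} => F j) ⟨j, hj⟩
  refine ⟨fun i => separation S (F i) (H i) ∩ U i,
    fun i => (isOpen_separation hS (hF i) _).inter (hU i),
    fun i => subset_inter (subset_separation hS hcl (hF i) (hH i) (hFH i)) (hFU i),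
    fun i => inter_subset_right, fun i j hij => ?_⟩
  refine Disjoint.mono
    (inter_subset_left.trans (separation_anti_right hS _ (hF j) (hH i) (hsub i j hij.symm)))
    (inter_subset_left.trans (separation_anti_right hS _ (hF i) (hH j) (hsub j i hij)))
    (disjoint_separation hS (F i) (F j))

end Separation

/-! ### Metrizability of stratifiable developable spaces -/

/-- Cutting a function `f` that vanishes outside a disjoint union of open sets into its restrictions
to these sets is continuous for uniform convergence over the index set. -/
theorem continuous_ofFun_indicator {ι : Type*} {O : ι → Set X} (hO : ∀ i, IsOpen (O i))
    (hdisj : Pairwise (Function.onFun Disjoint O)) (f : C(X, ℝ)) (hf : ∀ x ∉ ⋃ i, O i, f x = 0) :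
    Continuous fun x => UniformFun.ofFun fun i => (O i).indicator f x := by
  refine continuous_iff_continuousAt.2 fun x => ?_
  refine UniformFun.tendsto_iff_tendstoUniformly.2 (Metric.tendstoUniformly_iff.2 fun ε hε => ?_)
  have hfx : ∀ᶠ y in 𝓝 x, dist (f x) (f y) < ε := by
    simpa only [dist_comm] using Metric.tendsto_nhds.1 (f.continuous.tendsto x) ε hε
  by_cases hx : x ∈ ⋃ i, O i
  · obtain ⟨i, hi⟩ := mem_iUnion.1 hx
    filter_upwards [hfx, (hO i).mem_nhds hi] with y hy hyi j
    change dist ((O j).indicator f x) ((O j).indicator f y) < ε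
    by_cases hij : j = i
    · subst hij
      rwa [indicator_of_mem hi, indicator_of_mem hyi]
    · rw [indicator_of_notMem (disjoint_right.1 (hdisj hij) hi),
        indicator_of_notMem (disjoint_right.1 (hdisj hij) hyi), dist_self]
      exact hε
  · filter_upwards [hfx] with y hy j
    change dist ((O j).indicator f x) ((O j).indicator f y) < ε
    rw [indicator_of_notMem fun hj => hx (mem_iUnion.2 ⟨j, hj⟩)]
    by_cases hyj : y ∈ O j
    · rwa [indicator_of_mem hyj, ← hf x hx]
    · rw [indicator_of_notMem hyj, dist_self]
      exact hε

/-- The core pieces of a fixed level are recognised by one continuous map to a space of functions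
with the topology of uniform convergence. -/
theorem exists_continuous_forall_corePiece {S : ℕ → Set X → Set X}
    (hS : IsDecreasingSemiStratification S)
    (hcl : ∀ H, IsClosed H → ⋂ n, closure (S n H) = H) {ι : Type*} [LinearOrder ι]
    [WellFoundedLT ι] {U : ι → Set X} (hU : ∀ i, IsOpen (U i)) (hcov : ∀ x, ∃ i, x ∈ U i)
    (n : ℕ) :
    ∃ Φ : X → UniformFun ι ℝ, Continuous Φ ∧
      ∀ i, ∀ x ∈ corePiece S U n i, ∃ t ∈ 𝓝 (Φ x), Φ ⁻¹' t ⊆ U i := by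
  have := normalSpace_of_stratification hS hcl
  have hF : ∀ i, IsClosed (corePiece S U n i) := isClosed_corePiece hS hU n
  have hlf : LocallyFinite (corePiece S U n) := fun x => by
    obtain ⟨t, ht, i, hi⟩ := exists_nhds_corePiece_eq hS hU hcov n x
    exact ⟨t, ht, (finite_singleton i).subset fun j hj => hi j hj⟩
  have hdisj : Pairwise (Function.onFun Disjoint (corePiece S U n)) := fun i j hij => by
    refine disjoint_left.2 fun x hxi hxj => hij ?_
    obtain ⟨t, ht, k, hk⟩ := exists_nhds_corePiece_eq hS hU hcov n x
    exact (hk i ⟨x, hxi, mem_of_mem_nhds ht⟩).trans (hk j ⟨x, hxj, mem_of_mem_nhds ht⟩).symm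
  obtain ⟨O, hO, hFO, hOU, hOdisj⟩ := exists_pairwise_disjoint_expansion hS hcl hF hlf hdisj hU
    (corePiece_subset hS hU n)
  obtain ⟨f, hf0, hf1, -⟩ := exists_continuous_zero_one_of_isClosed
    (isOpen_iUnion hO).isClosed_compl (hlf.isClosed_iUnion hF)
    (disjoint_compl_left_iff_subset.2 (iUnion_mono hFO))
  refine ⟨fun x => UniformFun.ofFun fun i => (O i).indicator f x,
    continuous_ofFun_indicator hO hOdisj f fun x hx => hf0 hx, fun i x hx => ?_⟩
  have hev : Continuous fun g : UniformFun ι ℝ => UniformFun.toFun g i :=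
    (UniformFun.uniformContinuous_eval ℝ i).continuous
  refine ⟨{g | 0 < UniformFun.toFun g i}, (isOpen_lt continuous_const hev).mem_nhds ?_, ?_⟩
  · change 0 < (O i).indicator f x
    rw [indicator_of_mem (hFO i hx), hf1 (mem_iUnion.2 ⟨i, hx⟩)]
    exact one_pos
  · intro y hy
    change 0 < (O i).indicator f y at hy
    exact hOU i (mem_of_indicator_ne_zero hy.ne')

theorem Stratifiable.metrizableSpace_of_developable [T0Space X] (h : Stratifiable X)
    (hd : Developable X) : TopologicalSpace.MetrizableSpace X := by
  obtain ⟨S, hS, hcl⟩ := h.exists_decreasing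
  obtain ⟨𝒢, h𝒢, hbase⟩ := hd
  obtain ⟨_, _⟩ := exists_wellFoundedLT (α := X)
  choose U hUG hUm using fun k => (h𝒢 k).exists_mem
  have hU : ∀ k p, IsOpen (U k p) := fun k p => (h𝒢 k).1 _ (hUG k p)
  have hcov : ∀ k x, ∃ p, x ∈ U k p := fun k x => ⟨x, hUm k x⟩
  choose Φ hΦ hsep using fun k n =>
    exists_continuous_forall_corePiece hS hcl (hU k) (hcov k) n
  let Ψ : X → ℕ × ℕ → UniformFun X ℝ := fun x kn => Φ kn.1 kn.2 x
  have hΨ : Continuous Ψ := continuous_pi fun kn => hΦ kn.1 kn.2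
  have hind : IsInducing Ψ := by
    refine isInducing_iff_nhds.2 fun x => le_antisymm (hΨ.tendsto x).le_comap fun O hO => ?_
    obtain ⟨k, -, hk⟩ := (hbase x).mem_iff.1 hO
    obtain ⟨n, p, hp⟩ := exists_mem_corePiece hS (hU k) (hcov k) x
    obtain ⟨t, ht, htU⟩ := hsep k n p x hp
    refine ⟨(fun g => g (k, n)) ⁻¹' t, (continuous_apply (k, n)).continuousAt ht, fun y hy => ?_⟩
    exact hk (mem_star_iff.2
      ⟨U k p, hUG k p, corePiece_subset hS (hU k) n p hp, htU hy⟩)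
  have := hind.pseudoMetrizableSpace
  infer_instance

end GenMetric

theorem mainTheorem4 (X : Type*) [TopologicalSpace X] [T1Space X] [RegularSpace X] :
    (GenMetric.Developable X ↔
      GenMetric.SemiStratifiable X ∧ GenMetric.WeaklyWDeltaSpace X) ∧
    (TopologicalSpace.MetrizableSpace X ↔
      GenMetric.Stratifiable X ∧ GenMetric.WeaklyWDeltaSpace X) := by
  refine ⟨⟨?_, fun h => h.1.developable h.2⟩, fun _ => ?_, fun h => ?_⟩
  · rintro ⟨𝒢, h𝒢⟩
    exact ⟨h𝒢.semiStratifiable, 𝒢, h𝒢.isWeaklyWDeltaSequence⟩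
  · obtain ⟨𝒢, h𝒢⟩ := GenMetric.developable_of_metrizableSpace (X := X)
    exact ⟨GenMetric.stratifiable_of_metrizableSpace, 𝒢, h𝒢.isWeaklyWDeltaSequence⟩
  · exact h.1.metrizableSpace_of_developable (h.1.semiStratifiable.developable h.2)
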